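/- Let $K$ be a field, let $N,l\ge 0$ be integers, and let $i:Z\to\mathbb{P}=\mathbb{P}^N_K$ be a closed immersion of schemes such that $Z$ is projectively normal in $i$, i.e. the homogeneous coordinate ring $K[x_0,\dots,x_N]/I(Z)$ is an integrally closed domain, where $I(Z)$ is the ideal generated by the homogeneous polynomials that vanish on $Z$. For a separated morphism $\pi:X\to S$ of schemes let $p,q:X\times_S X\to X$ be the first and second projection, let $\mathcal{I}_\Delta$ be the ideal sheaf of the diagonal in $X\times_S X$, and put $\mathcal{O}_{\Delta^l}=\mathcal{O}_{X\times_S X}/\mathcal{I}_\Delta^{\,l+1}$. For an $\mathcal{O}_X$-module $\mathcal{E}$ let $$\mathcal{P}^l_{X/S}(\mathcal{E})=p_*(\mathcal{O}_{\Delta^l}\otimes q^*\mathcal{E})$$ be its $l$-th jet bundle (with its left $\mathcal{O}_X$-module structure), and let the $l$-th Taylor morphism $$T^l:\pi^*\pi_*\mathcal{E}\to p_*q^*\mathcal{E}\to\mathcal{P}^l_{X/S}(\mathcal{E})$$ be the composition of the base change morphism and the morphism induced by $\mathcal{O}_{X\times_S X}\to\mathcal{O}_{\Delta^l}$. For $S=\operatorname{Spec}K$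 we write $\mathcal{P}^l_X=\mathcal{P}^l_{X/S}$, and the source of $T^l$ is $H^0(X,\mathcal{E})\otimes_K\mathcal{O}_X$. Let $\mathcal{F}$ be a coherent $\mathcal{O}_{\mathbb{P}}$-module whose Taylor morphism $$T^l:H^0(\mathbb{P},\mathcal{F})\otimes_K\mathcal{O}_{\mathbb{P}}\to\mathcal{P}^l_{\mathbb{P}}(\mathcal{F})$$ is surjective. Then the Taylor morphism $$T^l:H^0(Z,i^*\mathcal{F})\otimes_K\mathcal{O}_Z\to\mathcal{P}^l_Z(i^*\mathcal{F})$$ is surjective. -/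

import Mathlib

open CategoryTheory AlgebraicGeometry

universe u

noncomputable section

namespace JetBundle

/-! ### Jet bundles and Taylor morphisms of a separated morphism `π : X ⟶ S` -/

section Jets

variable {X S : Scheme.{u}} (π : X ⟶ S)

/-- The first projection `p : X ×_S X ⟶ X`. -/
abbrev p : Limits.pullback π π ⟶ X := Limits.pullback.fst π π

/-- The second projection `q : X ×_S X ⟶ X`. -/
abbrev q : Limits.pullback π π ⟶ X := Limits.pullback.snd π π

/-- The ideal sheaf `I_Δ` of the diagonal `Δ : X ⟶ X ×_S X`, a closed immersion since `π` is
separated. -/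
def diagonalIdeal [IsSeparated π] : (Limits.pullback π π).IdealSheafData :=
  (Limits.pullback.diagonal π).ker

/-- The `l`-th infinitesimal neighbourhood of the diagonal: the closed subscheme `Δ^l` of
`X ×_S X` with ideal sheaf `I_Δ ^ (l + 1)`. -/
def infNhd [IsSeparated π] (l : ℕ) : Scheme.{u} :=
  (diagonalIdeal π ^ (l + 1)).subscheme

/-- The closed immersion `j : Δ^l ⟶ X ×_S X`. -/
def infNhdι [IsSeparated π] (l : ℕ) : infNhd π l ⟶ Limits.pullback π π :=
  (diagonalIdeal π ^ (l + 1)).subschemeι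

/-- The functor `G ↦ 𝒪_{Δ^l} ⊗ G` on `𝒪`-modules on `X ×_S X`, where
`𝒪_{Δ^l} = 𝒪 / I_Δ ^ (l + 1)`. For the closed immersion `j : Δ^l ⟶ X ×_S X` this is
`j_* j^* G` (that is, `G / I_Δ ^ (l + 1) G`). -/
def restrictToInfNhd [IsSeparated π] (l : ℕ) :
    (Limits.pullback π π).Modules ⥤ (Limits.pullback π π).Modules :=
  Scheme.Modules.pullback (infNhdι π l) ⋙ Scheme.Modules.pushforward (infNhdι π l)

/-- The natural map `G ⟶ 𝒪_{Δ^l} ⊗ G` induced by `𝒪 ⟶ 𝒪_{Δ^l}`. -/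
def toRestrictToInfNhd [IsSeparated π] (l : ℕ) :
    𝟭 (Limits.pullback π π).Modules ⟶ restrictToInfNhd π l :=
  (Scheme.Modules.pullbackPushforwardAdjunction (infNhdι π l)).unit

/-- The `l`-th jet bundle (sheaf of principal parts) `P^l_{X/S}(E) = p_*(𝒪_{Δ^l} ⊗ q^* E)`, with
its left `𝒪_X`-module structure. -/
def jetBundle [IsSeparated π] (l : ℕ) (E : X.Modules) : X.Modules :=
  (Scheme.Modules.pushforward (p π)).obj
    ((restrictToInfNhd π l).obj ((Scheme.Modules.pullback (q π)).obj E))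

/-- The identification `π_* q_* = π_* p_*`, from `q ≫ π = p ≫ π`. -/
def pushforwardSwap : Scheme.Modules.pushforward (q π) ⋙ Scheme.Modules.pushforward π ≅
    Scheme.Modules.pushforward (p π) ⋙ Scheme.Modules.pushforward π :=
  Scheme.Modules.pushforwardComp (q π) π ≪≫
    Scheme.Modules.pushforwardCongr Limits.pullback.condition.symm ≪≫
      (Scheme.Modules.pushforwardComp (p π) π).symm

/-- The base change morphism `π^* π_* E ⟶ p_* q^* E`: the adjoint of
`π_* E ⟶ π_* q_* q^* E = π_* p_* q^* E`. -/
def baseChangeMap (E : X.Modules) :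
    (Scheme.Modules.pullback π).obj ((Scheme.Modules.pushforward π).obj E) ⟶
      (Scheme.Modules.pushforward (p π)).obj ((Scheme.Modules.pullback (q π)).obj E) :=
  ((Scheme.Modules.pullbackPushforwardAdjunction π).homEquiv _ _).symm
    ((Scheme.Modules.pushforward π).map
        ((Scheme.Modules.pullbackPushforwardAdjunction (q π)).unit.app E) ≫
      (pushforwardSwap π).hom.app ((Scheme.Modules.pullback (q π)).obj E))

/-- The `l`-th Taylor morphism
`T^l : π^* π_* E ⟶ p_* q^* E ⟶ p_*(𝒪_{Δ^l} ⊗ q^* E) = P^l_{X/S}(E)`.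
If `S` is the spectrum of a field `K`, its source is `H^0(X, E) ⊗_K 𝒪_X`. -/
def taylorMap [IsSeparated π] (l : ℕ) (E : X.Modules) :
    (Scheme.Modules.pullback π).obj ((Scheme.Modules.pushforward π).obj E) ⟶ jetBundle π l E :=
  baseChangeMap π E ≫
    (Scheme.Modules.pushforward (p π)).map
      ((toRestrictToInfNhd π l).app ((Scheme.Modules.pullback (q π)).obj E))

end Jets

/-- A coherent module on a locally Noetherian scheme: quasi-coherent and of finite type. (The
definition is used on projective space over a field only.) -/
structure IsCoherent {X : Scheme.{u}} (F : X.Modules) : Prop where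
  isQuasicoherent : SheafOfModules.IsQuasicoherent.{u} (R := X.ringCatSheaf) F
  isFiniteType : SheafOfModules.IsFiniteType.{u} (R := X.ringCatSheaf) F

/-! ### Projective space and projective normality -/

section Projective

variable (N : ℕ) (K : Type u) [Field K]

/-- The standard grading of `K[x_0, …, x_N]`. -/
abbrev grading : ℕ → Submodule K (MvPolynomial (Fin (N + 1)) K) :=
  MvPolynomial.homogeneousSubmodule (Fin (N + 1)) K

instance : GradedAlgebra (grading N K) := MvPolynomial.gradedAlgebra

/-- Projective space `ℙ^N_K = Proj K[x_0, …, x_N]`. -/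
abbrev projectiveSpace : Scheme.{u} := Proj (grading N K)

/-- The structure morphism `ℙ^N_K ⟶ Spec K`. -/
def projectiveSpaceStr : projectiveSpace N K ⟶ Spec (CommRingCat.of K) :=
  Proj.toSpecZero (grading N K) ≫
    Spec.map (CommRingCat.ofHom (algebraMap K (grading N K 0)))

instance : IsSeparated (projectiveSpaceStr N K) := by
  unfold projectiveSpaceStr
  infer_instance

variable {N K}

/-- The function `f / x_j ^ d` on the standard open subset `{x_j ≠ 0}` of `ℙ^N_K`, for a
homogeneous polynomial `f` of degree `d`. -/
def dehomogenize (j : Fin (N + 1)) {d : ℕ} {f : MvPolynomial (Fin (N + 1)) K}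
    (hf : f ∈ grading N K d) :
    Γ(projectiveSpace N K, Proj.basicOpen (grading N K) (MvPolynomial.X j)) :=
  (Proj.awayToSection (grading N K) (MvPolynomial.X j)).hom
    (HomogeneousLocalization.Away.mk (grading N K) (d := 1)
      ((MvPolynomial.mem_homogeneousSubmodule 1 _).mpr (MvPolynomial.isHomogeneous_X K j))
      d f (by simpa using hf))

/-- The (saturated) homogeneous ideal of a closed subscheme `i : Z ⟶ ℙ^N_K`: it is generated by
the homogeneous polynomials that vanish on `Z`, where `f` of degree `d` vanishes on `Z` if all the
functions `f / x_j ^ d` pull back to `0` on `Z ∩ {x_j ≠ 0}`. -/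
def homogeneousIdeal {Z : Scheme.{u}} (i : Z ⟶ projectiveSpace N K) :
    Ideal (MvPolynomial (Fin (N + 1)) K) :=
  Ideal.span {f | ∃ (d : ℕ) (hf : f ∈ grading N K d), ∀ j : Fin (N + 1),
    (i.app (Proj.basicOpen (grading N K) (MvPolynomial.X j))).hom (dehomogenize j hf) = 0}

/-- A closed subscheme `i : Z ⟶ ℙ^N_K` is projectively normal if its homogeneous coordinate ring
is an integrally closed domain. -/
structure IsProjectivelyNormal {Z : Scheme.{u}} (i : Z ⟶ projectiveSpace N K) : Prop where
  isDomain : IsDomain (MvPolynomial (Fin (N + 1)) K ⧸ homogeneousIdeal i)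
  isIntegrallyClosed :
    IsIntegrallyClosed (MvPolynomial (Fin (N + 1)) K ⧸ homogeneousIdeal i)

end Projective

end JetBundle

end

/-! The statement holds for any closed immersion `a : Z ⟶ X` over `S` with `X` separated over `S`.
Let `j`, `j'` be the immersions of the `l`-th diagonal neighbourhoods of `X` and `Z`. Since `a`
carries one diagonal into the other, it induces a closed immersion `f` between these neighbourhoods,
and a comparison `j^* q^* F ⟶ f_* j'^* q'^* a^* F`.

The Taylor morphism of `F` followed by this comparison equals a map on global sections followed by
`a_*` of the Taylor morphism of `a^* F` (`taylorMap_comp_infNhdPullbackMap`). The comparison is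
locally surjective: its target is generated by sections pulled back from `F`, and functions lift
locally along `f` (`isLocallySurjective_of_generates`). It stays so after pushforward to `X`,
because `Δ^l ⟶ X` is a homeomorphism. Hence `a_*` of the second Taylor morphism is epi, and `a_*`,
being faithful, reflects epimorphisms. -/

namespace AlgebraicGeometry.Scheme.Modules

open TopologicalSpace Opposite

/-! ### Sections and submodules of `𝒪`-modules. -/

variable {X Y : Scheme.{u}}

/-- Restriction of a section of an `𝒪`-module to a smaller open subset. -/
noncomputable def res (M : X.Modules) {U V : X.Opens} (h : V ≤ U) : Γ(M, U) →+ Γ(M, V) :=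
  (M.presheaf.map (homOfLE h).op).hom

lemma res_res (M : X.Modules) {U V W : X.Opens} (h : V ≤ U) (h' : W ≤ V) (m : Γ(M, U)) :
    M.res h' (M.res h m) = M.res (h'.trans h) m := by
  have := congr($(M.presheaf.map_comp (homOfLE h).op (homOfLE h').op) m)
  exact this.symm

@[simp]
lemma res_self (M : X.Modules) {U : X.Opens} (h : U ≤ U) (m : Γ(M, U)) :
    M.res h m = m :=
  congr($(M.presheaf.map_id (op U)) m)

lemma app_res {M N : X.Modules} (φ : M ⟶ N) {U V : X.Opens} (h : V ≤ U) (m : Γ(M, U)) :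
    φ.app V (M.res h m) = N.res h (φ.app U m) :=
  congr($(φ.mapPresheaf.naturality (homOfLE h).op) m)

lemma res_smul (M : X.Modules) {U V : X.Opens} (h : V ≤ U) (r : Γ(X, U)) (m : Γ(M, U)) :
    M.res h (r • m) = X.presheaf.map (homOfLE h).op r • M.res h m :=
  M.map_smul (homOfLE h) r m

lemma eq_of_locally_eq (M : X.Modules) {U : X.Opens} (m n : Γ(M, U))
    (h : ∀ x ∈ U, ∃ (V : X.Opens) (hV : V ≤ U), x ∈ V ∧ M.res hV m = M.res hV n) : m = n := by
  choose! V hV hx e using h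
  refine TopCat.Sheaf.eq_of_locally_eq' ⟨M.presheaf, M.isSheaf⟩ (fun x : U ↦ V x) U
    (fun x ↦ homOfLE (hV x x.2)) (fun x hxU ↦ ?_) m n fun x ↦ e x x.2
  exact (Opens.mem_iSup (s := fun x : U ↦ V x)).mpr ⟨⟨x, hxU⟩, hx x hxU⟩

/-- A submodule of an `𝒪`-module, given by a family of submodules of sections stable under
restriction for which membership is a local condition. -/
structure Subsheaf (M : X.Modules) where
  /-- the sections of the submodule -/
  obj (U : X.Opens) : Submodule Γ(X, U) Γ(M, U)
  res_mem {U V : X.Opens} (h : V ≤ U) {m : Γ(M, U)} (hm : m ∈ obj U) : M.res h m ∈ obj V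
  mem_of_locally {U : X.Opens} {m : Γ(M, U)}
    (h : ∀ x ∈ U, ∃ (V : X.Opens) (hV : V ≤ U), x ∈ V ∧ M.res hV m ∈ obj V) : m ∈ obj U

namespace Subsheaf

variable {M : X.Modules} (N : M.Subsheaf)

/-- The underlying submodule of the presheaf of modules. -/
def toSubmodule : PresheafOfModules.Submodule M.val where
  obj U := N.obj U.unop
  map f _ hm := N.res_mem (leOfHom f.unop) hm

lemma isSheaf : TopCat.Presheaf.IsSheaf (X := X.toTopCat)
    (N.toSubmodule.toPresheafOfModules.presheaf) := by
  rw [TopCat.Presheaf.isSheaf_iff_isSheafUniqueGluing]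
  intro ι U sf hsf
  obtain ⟨s, hs, hs'⟩ := M.isSheaf.isSheafUniqueGluing U (fun i ↦ (sf i).1)
    (fun i j ↦ congr_arg Subtype.val (hsf i j))
  refine ⟨⟨s, N.mem_of_locally fun x hx ↦ ?_⟩, fun i ↦ Subtype.ext (hs i), fun t ht ↦
    Subtype.ext (hs' _ fun i ↦ congr_arg Subtype.val (ht i))⟩
  obtain ⟨i, hi⟩ := Opens.mem_iSup.mp hx
  refine ⟨U i, le_iSup U i, hi, ?_⟩
  have : M.res (le_iSup U i) s = (sf i).1 := hs i
  rw [this]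
  exact (sf i).2

/-- The `𝒪`-module attached to a submodule. -/
noncomputable def toModules : X.Modules where
  val := N.toSubmodule.toPresheafOfModules
  isSheaf := N.isSheaf

/-- The inclusion of a submodule. -/
noncomputable def ι : N.toModules ⟶ M := ⟨N.toSubmodule.ι⟩

lemma ι_app_mem {U : X.Opens} (m : Γ(N.toModules, U)) : N.ι.app U m ∈ N.obj U :=
  Subtype.prop (p := (· ∈ N.obj U)) m

lemma ι_app_injective (U : X.Opens) : Function.Injective (N.ι.app U) :=
  Subtype.val_injective (p := (· ∈ N.obj U))

instance : Mono N.ι where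
  right_cancellation f g h := by
    ext U x
    exact N.ι_app_injective U congr(($h).app U x)

/-- A mono that is epi is an isomorphism of `𝒪`-modules, hence surjective on sections over every
open set. -/
lemma eq_top_of_epi_ι [Epi N.ι] (U : X.Opens) : N.obj U = ⊤ := by
  have : IsIso N.ι := isIso_of_mono_of_epi _
  refine eq_top_iff.mpr fun m _ ↦ ?_
  have h : N.ι.app U ((inv N.ι).app U m) = m :=
    congr(($(IsIso.inv_hom_id N.ι)).app U m)
  rw [← h]
  exact N.ι_app_mem _

end Subsheaf

end AlgebraicGeometry.Scheme.Modules

/-! ### Local surjectivity and closed immersions. -/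

namespace AlgebraicGeometry.Scheme

open TopologicalSpace Opposite

variable {X Y : Scheme.{u}}

lemma Hom.exists_preimage_le (f : X ⟶ Y) (hf : Topology.IsInducing f) {V : X.Opens} {x : X}
    (hx : x ∈ V) : ∃ U : Y.Opens, f x ∈ U ∧ f ⁻¹ᵁ U ≤ V := by
  obtain ⟨U, hU, e⟩ := hf.isOpen_iff.mp V.2
  exact ⟨⟨U, hU⟩, by change x ∈ f ⁻¹' U; rwa [e],
    fun y hy ↦ by change y ∈ V.carrier; rwa [← e]⟩

/-- Functions on an immersed scheme lift locally to functions on the ambient scheme. -/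
lemma Hom.exists_app_eq_map (f : X ⟶ Y) [IsPreimmersion f] {V : X.Opens} (b : Γ(X, V)) {x : X}
    (hx : x ∈ V) : ∃ (U : Y.Opens) (h : f ⁻¹ᵁ U ≤ V) (a : Γ(Y, U)), f x ∈ U ∧
      f.app U a = X.presheaf.map (homOfLE h).op b := by
  obtain ⟨s, hs⟩ := f.stalkMap_surjective x (X.presheaf.germ V x hx b)
  obtain ⟨U, hxU, a, rfl⟩ := Y.presheaf.exists_germ_eq s
  rw [f.germ_stalkMap_apply] at hs
  obtain ⟨W, hxW, i, j, e⟩ := X.presheaf.germ_eq x _ _ _ _ hs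
  obtain ⟨U', hxU', h⟩ := f.exists_preimage_le f.isEmbedding.isInducing hxW
  refine ⟨U ⊓ U', fun y hy ↦ leOfHom j (h hy.2), Y.presheaf.map (homOfLE inf_le_left).op a,
    ⟨hxU, hxU'⟩, ?_⟩
  have hW : f ⁻¹ᵁ (U ⊓ U') ≤ W := fun y hy ↦ h hy.2
  have e' := congr(X.presheaf.map (homOfLE hW).op $e)
  have e₁ := congr($(f.naturality (homOfLE (inf_le_left : U ⊓ U' ≤ U)).op) a)
  simp only [← CommRingCat.comp_apply, ← Functor.map_comp, Category.assoc] at e' e₁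
  exact e₁.trans e'

namespace Modules

section

variable {f : X ⟶ Y} {G : Y.Modules} {M : X.Modules} (β : G ⟶ (pushforward f).obj M)

/-- The action on sections of a morphism `G ⟶ f_* M`. -/
noncomputable def appPushforward (U : Y.Opens) : Γ(G, U) →+ Γ(M, f ⁻¹ᵁ U) := (β.app U).hom

lemma appPushforward_res {U V : Y.Opens} (h : V ≤ U) (g : Γ(G, U)) :
    appPushforward β V (G.res h g) = M.res (f.preimage_mono h) (appPushforward β U g) :=
  app_res β h g

lemma appPushforward_smul {U : Y.Opens} (r : Γ(Y, U)) (g : Γ(G, U)) :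
    appPushforward β U (r • g) = f.app U r • appPushforward β U g :=
  β.app_smul r g

end

/-- A morphism of `𝒪`-modules through which every section lifts locally. -/
def IsLocallySurjective {M N : X.Modules} (φ : M ⟶ N) : Prop :=
  ∀ ⦃U : X.Opens⦄ (n : Γ(N, U)), ∀ x ∈ U, ∃ (V : X.Opens) (h : V ≤ U) (m : Γ(M, V)),
    x ∈ V ∧ φ.app V m = N.res h n

lemma IsLocallySurjective.epi {M N : X.Modules} {φ : M ⟶ N} (hφ : IsLocallySurjective φ) :
    Epi φ where
  left_cancellation {K} u v h := by
    ext U n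
    refine eq_of_locally_eq K _ _ fun x hx ↦ ?_
    obtain ⟨V, hV, m, hxV, e⟩ := hφ n x hx
    refine ⟨V, hV, hxV, ?_⟩
    rw [← app_res, ← app_res, ← e]
    exact congr(($h).app V m)

section Image

variable (f : X ⟶ Y) [IsClosedImmersion f] {G : Y.Modules} {M : X.Modules}
  (β : G ⟶ (pushforward f).obj M)

/-- The submodule of `M` generated by the image of a morphism `G ⟶ f_* M`, for a closed
immersion `f`. -/
noncomputable def generatedSubsheaf : M.Subsheaf where
  obj V :=
    { carrier := {m | ∀ x ∈ V, ∃ (U : Y.Opens) (h : f ⁻¹ᵁ U ≤ V) (g : Γ(G, U)), f x ∈ U ∧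
        appPushforward β U g = M.res h m}
      zero_mem' x hx := by
        obtain ⟨U, hxU, h⟩ := f.exists_preimage_le f.isClosedEmbedding.isInducing hx
        exact ⟨U, h, 0, hxU, by simp⟩
      add_mem' {m n} hm hn x hx := by
        obtain ⟨U, h, g, hxU, e⟩ := hm x hx
        obtain ⟨U', h', g', hxU', e'⟩ := hn x hx
        refine ⟨U ⊓ U', fun y hy ↦ h hy.1, G.res inf_le_left g + G.res inf_le_right g',
          ⟨hxU, hxU'⟩, ?_⟩
        rw [map_add, map_add, appPushforward_res, appPushforward_res, e, e', res_res, res_res]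
      smul_mem' r m hm x hx := by
        obtain ⟨U, h, g, hxU, e⟩ := hm x hx
        obtain ⟨U', h', a, hxU', e'⟩ := f.exists_app_eq_map r hx
        refine ⟨U ⊓ U', fun y hy ↦ h hy.1,
          (show Γ(Y, U ⊓ U') from Y.presheaf.map (homOfLE inf_le_right).op a) •
            G.res (V := U ⊓ U') inf_le_left g, ⟨hxU, hxU'⟩, ?_⟩
        have e₁ := congr($(f.naturality (homOfLE (inf_le_right : U ⊓ U' ≤ U')).op) a)
        have e₂ := congr(X.presheaf.map
          (homOfLE (f.preimage_mono (inf_le_right : U ⊓ U' ≤ U'))).op $e')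
        simp only [← CommRingCat.comp_apply, ← Functor.map_comp] at e₁ e₂
        rw [appPushforward_smul, appPushforward_res, e, res_smul, res_res]
        congr 1
        exact e₁.trans e₂ }
  res_mem {U V} h m hm x hx := by
    obtain ⟨W, hW, g, hxW, e⟩ := hm x (h hx)
    obtain ⟨W', hxW', hW'⟩ := f.exists_preimage_le f.isClosedEmbedding.isInducing hx
    refine ⟨W ⊓ W', fun y hy ↦ hW' hy.2, G.res inf_le_left g, ⟨hxW, hxW'⟩, ?_⟩
    rw [appPushforward_res, e, res_res, res_res]
  mem_of_locally {V m} h x hx := by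
    obtain ⟨V', hV', hxV', hm⟩ := h x hx
    obtain ⟨U, hU, g, hxU, e⟩ := hm x hxV'
    refine ⟨U, hU.trans hV', g, hxU, ?_⟩
    rw [e, res_res]

lemma mem_generatedSubsheaf (U : Y.Opens) (g : Γ(G, U)) :
    appPushforward β U g ∈ (generatedSubsheaf f β).obj (f ⁻¹ᵁ U) :=
  fun _ hx ↦ ⟨U, le_rfl, g, hx, (res_self M _ _).symm⟩

lemma subsingleton_of_isEmpty (M : X.Modules) {U : X.Opens} (hU : ∀ x, x ∉ U) :
    Subsingleton Γ(M, U) :=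
  ⟨fun m n ↦ eq_of_locally_eq M m n fun x hx ↦ (hU x hx).elim⟩

/-- Let `f` be a closed immersion and `G ⟶ f_* M` a morphism whose image generates `M`. Then it is
locally surjective. -/
lemma isLocallySurjective_of_generates
    (hβ : ∀ ⦃N : X.Modules⦄ (u v : M ⟶ N),
      β ≫ (pushforward f).map u = β ≫ (pushforward f).map v → u = v) :
    IsLocallySurjective β := by
  let N := generatedSubsheaf f β
  have hι : Epi N.ι := by
    -- The projection to the cokernel kills the image of `β`, so `hβ` identifies it with zero.
    refine Preadditive.epi_of_cokernel_zero (hβ _ _ ?_)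
    ext U g
    have hz : (Limits.cokernel.π N.ι).app _ (appPushforward β U g) = 0 :=
      congr(($(Limits.cokernel.condition N.ι)).app _
        (show N.obj (f ⁻¹ᵁ U) from ⟨_, mem_generatedSubsheaf f β U g⟩))
    rw [Functor.map_zero]
    exact hz
  intro U m y hy
  by_cases h : ∃ x, f x = y
  · obtain ⟨x, rfl⟩ := h
    let m' : Γ(M, f ⁻¹ᵁ U) := m
    have hm : m' ∈ N.obj (f ⁻¹ᵁ U) := by rw [N.eq_top_of_epi_ι]; trivial
    obtain ⟨V, hV, g, hxV, e⟩ := hm x hy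
    refine ⟨U ⊓ V, inf_le_left, G.res inf_le_right g, ⟨hy, hxV⟩, ?_⟩
    change appPushforward β _ _ = M.res (f.preimage_mono inf_le_left) m'
    rw [appPushforward_res, e, res_res]
  -- Off the closed image the pushforward has only zero sections.
  · let W : Y.Opens := ⟨(Set.range f)ᶜ, f.isClosedEmbedding.isClosed_range.isOpen_compl⟩
    refine ⟨U ⊓ W, inf_le_left, 0, ⟨hy, h⟩, ?_⟩
    exact (subsingleton_of_isEmpty M (U := f ⁻¹ᵁ (U ⊓ W)) fun x hx ↦ hx.2 ⟨x, rfl⟩).elim _ _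

end Image

/-- Pushforward along a topological closed embedding preserves local surjectivity. -/
lemma IsLocallySurjective.pushforward {M N : X.Modules} {φ : M ⟶ N} (hφ : IsLocallySurjective φ)
    (f : X ⟶ Y) (hf : Topology.IsClosedEmbedding f) :
    IsLocallySurjective ((pushforward f).map φ) := by
  intro U n y hy
  by_cases h : ∃ x, f x = y
  · obtain ⟨x, rfl⟩ := h
    obtain ⟨V, hV, m, hxV, e⟩ := hφ (U := f ⁻¹ᵁ U) n x hy
    obtain ⟨W, hxW, hW⟩ := f.exists_preimage_le hf.isInducing hxV
    refine ⟨U ⊓ W, inf_le_left, M.res (show f ⁻¹ᵁ (U ⊓ W) ≤ V from fun y hy ↦ hW hy.2) m, ⟨hy, hxW⟩, ?_⟩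
    refine (app_res φ _ m).trans ?_
    rw [e]
    exact res_res N _ _ _
  · let W : Y.Opens := ⟨(Set.range f)ᶜ, hf.isClosed_range.isOpen_compl⟩
    refine ⟨U ⊓ W, inf_le_left, 0, ⟨hy, h⟩, ?_⟩
    exact (subsingleton_of_isEmpty N (U := f ⁻¹ᵁ (U ⊓ W)) fun x hx ↦ hx.2 ⟨x, rfl⟩).elim _ _

/-- The opens `f ⁻¹ᵁ U` form a basis of `X`, and a morphism is determined on a basis. -/
lemma faithful_pushforward (f : X ⟶ Y) (hf : Topology.IsInducing f) :
    (Modules.pushforward f).Faithful where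
  map_injective {M N} u v h := by
    ext V m
    refine eq_of_locally_eq N _ _ fun x hx ↦ ?_
    obtain ⟨U, hxU, hU⟩ := f.exists_preimage_le hf hx
    refine ⟨f ⁻¹ᵁ U, hU, hxU, ?_⟩
    rw [← app_res, ← app_res]
    exact congr(($h).app U (M.res hU m))

end Modules

end AlgebraicGeometry.Scheme

/-! ### Pulled-back sections, comparison maps and base change. -/

namespace AlgebraicGeometry.Scheme.Modules

variable {X Y Z : Scheme.{u}}

section

variable (f : X ⟶ Y) {G : Y.Modules} {M : X.Modules}

/-- The unit `G ⟶ f_* f^* G`. -/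
noncomputable def pullbackUnit (G : Y.Modules) :
    G ⟶ (pushforward f).obj ((pullback f).obj G) :=
  (pullbackPushforwardAdjunction f).unit.app G

/-- The pullback of sections of an `𝒪`-module. -/
noncomputable def pullbackSection (G : Y.Modules) (U : Y.Opens) :
    Γ(G, U) →+ Γ((pullback f).obj G, f ⁻¹ᵁ U) :=
  appPushforward (pullbackUnit f G) U

lemma pullback_hom_ext {u v : (pullback f).obj G ⟶ M}
    (h : ∀ U g, u.app _ (pullbackSection f G U g) = v.app _ (pullbackSection f G U g)) :
    u = v := by
  apply ((pullbackPushforwardAdjunction f).homEquiv G M).injective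
  rw [Adjunction.homEquiv_unit, Adjunction.homEquiv_unit]
  ext U g
  exact h U g

/-- The morphism `f^* G ⟶ M` adjoint to a morphism `G ⟶ f_* M`. -/
noncomputable def pullbackLift (γ : G ⟶ (pushforward f).obj M) : (pullback f).obj G ⟶ M :=
  ((pullbackPushforwardAdjunction f).homEquiv G M).symm γ

lemma pullbackUnit_pullbackLift (γ : G ⟶ (pushforward f).obj M) :
    pullbackUnit f G ≫ (pushforward f).map (pullbackLift f γ) = γ := by
  have h := ((pullbackPushforwardAdjunction f).homEquiv G M).apply_symm_apply γ
  rwa [Adjunction.homEquiv_unit] at h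

lemma pullbackLift_app (γ : G ⟶ (pushforward f).obj M) (U : Y.Opens) (g : Γ(G, U)) :
    (pullbackLift f γ).app _ (pullbackSection f G U g) = appPushforward γ U g :=
  congr(($(pullbackUnit_pullbackLift f γ)).app U g)

end

/-- The identification of threefold pushforwards along two equal compositions. -/
noncomputable def pushforwardTriple {W X' Y' : Scheme.{u}} {f : W ⟶ X} {g : X ⟶ Y} {k : Y ⟶ Z}
    {f' : W ⟶ X'} {g' : X' ⟶ Y'} {k' : Y' ⟶ Z} (h : f ≫ g ≫ k = f' ≫ g' ≫ k') (M : W.Modules) :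
    (pushforward k).obj ((pushforward g).obj ((pushforward f).obj M)) ≅
      (pushforward k').obj ((pushforward g').obj ((pushforward f').obj M)) :=
  (pushforwardComp g k).app _ ≪≫ (pushforwardComp f (g ≫ k)).app M ≪≫ (pushforwardCongr h).app M ≪≫
    ((pushforwardComp f' (g' ≫ k')).app M).symm ≪≫ ((pushforwardComp g' k').app _).symm

/-- These opens are not definitionally equal, so formulas on sections carry a restriction along this
equality. -/
lemma preimage_triple {W X' Y' : Scheme.{u}} {f : W ⟶ X} {g : X ⟶ Y} {k : Y ⟶ Z}
    {f' : W ⟶ X'} {g' : X' ⟶ Y'} {k' : Y' ⟶ Z} (h : f ≫ g ≫ k = f' ≫ g' ≫ k') (U : Z.Opens) :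
    f' ⁻¹ᵁ g' ⁻¹ᵁ k' ⁻¹ᵁ U = f ⁻¹ᵁ g ⁻¹ᵁ k ⁻¹ᵁ U :=
  congr($h.symm ⁻¹ᵁ U)

/-- Allows pushing forward along the composite in one go, when `g` alone need not preserve
epimorphisms. -/
lemma epi_pushforward_map_map (f : X ⟶ Y) (g : Y ⟶ Z) {M N : X.Modules} (φ : M ⟶ N)
    (h : Epi ((pushforward (f ≫ g)).map φ)) :
    Epi ((pushforward g).map ((pushforward f).map φ)) :=
  ((MorphismProperty.epimorphisms _).arrow_mk_iso_iff
    (Arrow.isoMk ((pushforwardComp f g).app M) ((pushforwardComp f g).app N)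
      ((pushforwardComp f g).hom.naturality φ).symm)).mpr h

lemma epi_middle {C : Type*} [Category* C] {A B P Q R : C} {t : A ⟶ B} {e : B ⟶ R} {g : A ⟶ P}
    {m : P ⟶ Q} {i : Q ≅ R} (h : t ≫ e = g ≫ m ≫ i.hom) (_ : Epi t) (_ : Epi e) : Epi m := by
  have h' : (t ≫ e) ≫ i.inv = g ≫ m := by simp [h]
  have : Epi (g ≫ m) := h' ▸ inferInstance
  exact epi_of_epi g m

section Square

variable {D D' W W' : Scheme.{u}} {a : Z ⟶ X} {q : W ⟶ X} {j : D ⟶ W} {q' : W' ⟶ Z} {j' : D' ⟶ W'}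
  {f : D' ⟶ D} {F : X.Modules} {A : Z.Modules} {B : W'.Modules} {C : D'.Modules}

/-- The morphism `j^* q^* F ⟶ f_* C` attached to a commutative diagram `a ∘ q' ∘ j' = q ∘ j ∘ f` and
morphisms `F ⟶ a_* A`, `A ⟶ q'_* B` and `B ⟶ j'_* C`. -/
noncomputable def squareMap (h : j' ≫ q' ≫ a = f ≫ j ≫ q) (α : F ⟶ (pushforward a).obj A)
    (β : A ⟶ (pushforward q').obj B) (γ : B ⟶ (pushforward j').obj C) :
    (pullback j).obj ((pullback q).obj F) ⟶ (pushforward f).obj C :=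
  pullbackLift j (pullbackLift q
    (α ≫ (pushforward a).map (β ≫ (pushforward q').map γ) ≫ (pushforwardTriple h C).hom))

lemma squareMap_app (h : j' ≫ q' ≫ a = f ≫ j ≫ q) (α : F ⟶ (pushforward a).obj A)
    (β : A ⟶ (pushforward q').obj B) (γ : B ⟶ (pushforward j').obj C) (U : X.Opens) (t : Γ(F, U)) :
    appPushforward (squareMap h α β γ) _ (pullbackSection j _ _ (pullbackSection q F U t)) =
      C.res (preimage_triple h U).le
        (appPushforward γ _ (appPushforward β _ (appPushforward α U t))) :=
  (pullbackLift_app j _ _ _).trans (pullbackLift_app q _ U t)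

/-- The comparison sends pulled-back sections of `F` to pulled-back sections, and by adjunction,
applied once per pullback, these detect morphisms out of the threefold pullback. -/
lemma squareMap_pullbackUnit_generates (h : j' ≫ q' ≫ a = f ≫ j ≫ q) {N : D'.Modules}
    (u v : (pullback j').obj ((pullback q').obj ((pullback a).obj F)) ⟶ N)
    (huv : squareMap h (pullbackUnit a F) (pullbackUnit q' _) (pullbackUnit j' _) ≫
        (pushforward f).map u =
      squareMap h (pullbackUnit a F) (pullbackUnit q' _) (pullbackUnit j' _) ≫
        (pushforward f).map v) : u = v := by
  have key (U : X.Opens) (t : Γ(F, U)) :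
      u.app _ (pullbackSection j' _ _ (pullbackSection q' _ _ (pullbackSection a F U t))) =
        v.app _ (pullbackSection j' _ _ (pullbackSection q' _ _ (pullbackSection a F U t))) := by
    have e := congr(($huv).app _ (pullbackSection j _ _ (pullbackSection q F U t)))
    have e₀ := squareMap_app h (pullbackUnit a F) (pullbackUnit q' _) (pullbackUnit j' _) U t
    have e' := (congrArg (u.app _) e₀).symm.trans (e.trans (congrArg (v.app _) e₀))
    have e'' := congrArg (N.res (preimage_triple h U).ge) e'
    rw [app_res, app_res, res_res, res_res, res_self, res_self] at e''
    exact e''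
  have h₁ : pullbackUnit j' _ ≫ (pushforward j').map u =
      pullbackUnit j' _ ≫ (pushforward j').map v := by
    have h₂ : pullbackUnit q' _ ≫
          (pushforward q').map (pullbackUnit j' _ ≫ (pushforward j').map u) =
        pullbackUnit q' _ ≫ (pushforward q').map (pullbackUnit j' _ ≫ (pushforward j').map v) :=
      pullback_hom_ext a key
    exact pullback_hom_ext q' fun U t ↦ congr(($h₂).app U t)
  exact pullback_hom_ext j' fun U t ↦ congr(($h₁).app U t)

end Square

section BaseChange

variable {S D W : Scheme.{u}} {π : X ⟶ S} {p q : W ⟶ X} {j : D ⟶ W}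
  {E : X.Modules} {B : W.Modules} {C : D.Modules}

lemma preimage_square (h : q ≫ π = p ≫ π) (U : S.Opens) :
    p ⁻¹ᵁ π ⁻¹ᵁ U = q ⁻¹ᵁ π ⁻¹ᵁ U :=
  congr($h.symm ⁻¹ᵁ U)

/-- The morphism `π^* π_* E ⟶ p_* j_* C` attached to a commutative diagram `π ∘ q = π ∘ p` and
morphisms `E ⟶ q_* B` and `B ⟶ j_* C`. -/
noncomputable def baseChangeLift (h : q ≫ π = p ≫ π) (β : E ⟶ (pushforward q).obj B)
    (γ : B ⟶ (pushforward j).obj C) :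
    (pullback π).obj ((pushforward π).obj E) ⟶ (pushforward p).obj ((pushforward j).obj C) :=
  pullbackLift π ((pushforward π).map β ≫ (pushforwardComp q π ≪≫ pushforwardCongr h ≪≫
    (pushforwardComp p π).symm).hom.app B) ≫ (pushforward p).map γ

lemma baseChangeLift_app (h : q ≫ π = p ≫ π) (β : E ⟶ (pushforward q).obj B)
    (γ : B ⟶ (pushforward j).obj C) (U : S.Opens) (t : Γ(E, π ⁻¹ᵁ U)) :
    appPushforward (baseChangeLift h β γ) (π ⁻¹ᵁ U)
        (pullbackSection π ((pushforward π).obj E) U t) =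
      appPushforward γ _ (B.res (preimage_square h U).le (appPushforward β (π ⁻¹ᵁ U) t)) :=
  congrArg (appPushforward γ _) (pullbackLift_app π ((pushforward π).map β ≫
    (pushforwardComp q π ≪≫ pushforwardCongr h ≪≫ (pushforwardComp p π).symm).hom.app B) U t)

variable {D' W' : Scheme.{u}} {a : Z ⟶ X} {p' q' : W' ⟶ Z} {j' : D' ⟶ W'} {f : D' ⟶ D}
  {A : Z.Modules} {B' : W'.Modules} {C' : D'.Modules}

/-- The morphism `π^* π_* E ⟶ a_* (π')^* π'_* A` induced by a morphism `E ⟶ a_* A`, where `π'` is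
the composition of `a` and `π`. -/
noncomputable def globalSectionsMap (π : X ⟶ S) (α : E ⟶ (pushforward a).obj A) :
    (pullback π).obj ((pushforward π).obj E) ⟶
      (pushforward a).obj ((pullback (a ≫ π)).obj ((pushforward (a ≫ π)).obj A)) :=
  pullbackLift π ((pushforward π).map α ≫ (pushforwardComp a π).hom.app A ≫
    pullbackUnit (a ≫ π) ((pushforward (a ≫ π)).obj A) ≫ (pushforwardComp a π).inv.app _)

lemma globalSectionsMap_app (α : E ⟶ (pushforward a).obj A) (U : S.Opens) (t : Γ(E, π ⁻¹ᵁ U)) :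
    appPushforward (globalSectionsMap π α) (π ⁻¹ᵁ U)
        (pullbackSection π ((pushforward π).obj E) U t) =
      pullbackSection (a ≫ π) ((pushforward (a ≫ π)).obj A) U (appPushforward α (π ⁻¹ᵁ U) t) :=
  pullbackLift_app π ((pushforward π).map α ≫ (pushforwardComp a π).hom.app A ≫
    pullbackUnit (a ≫ π) ((pushforward (a ≫ π)).obj A) ≫ (pushforwardComp a π).inv.app _) U t

lemma baseChangeLift_comp (h : q ≫ π = p ≫ π) (h' : q' ≫ a ≫ π = p' ≫ a ≫ π)
    (hp : j' ≫ p' ≫ a = f ≫ j ≫ p) (hq : j' ≫ q' ≫ a = f ≫ j ≫ q)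
    (α : E ⟶ (pushforward a).obj A) (β : E ⟶ (pushforward q).obj B)
    (γ : B ⟶ (pushforward j).obj C) (β' : A ⟶ (pushforward q').obj B')
    (γ' : B' ⟶ (pushforward j').obj C') (δ : C ⟶ (pushforward f).obj C')
    (H : ∀ U t, appPushforward δ _ (appPushforward γ _ (appPushforward β U t)) =
      C'.res (preimage_triple hq U).le
        (appPushforward γ' _ (appPushforward β' _ (appPushforward α U t)))) :
    baseChangeLift h β γ ≫ (pushforward p).map ((pushforward j).map δ) =
      globalSectionsMap π α ≫ (pushforward a).map (baseChangeLift h' β' γ') ≫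
        (pushforwardTriple hp C').hom := by
  -- On pulled-back sections both composites reduce to the two sides of `H`, up to restriction along
  -- equalities of opens.
  refine pullback_hom_ext π fun U t ↦ ?_
  let t' : Γ(E, π ⁻¹ᵁ U) := t
  have e₁ := congrArg (appPushforward δ _) (baseChangeLift_app h β γ U t')
  have e₂ := congrArg (appPushforward (baseChangeLift h' β' γ') _)
    (globalSectionsMap_app (π := π) α U t')
  have e₃ := baseChangeLift_app h' β' γ' U (appPushforward α (π ⁻¹ᵁ U) t')
  have e₄ := congrArg (C'.res (preimage_triple hp (π ⁻¹ᵁ U)).le) (e₂.trans e₃)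
  refine e₁.trans (Eq.trans ?_ e₄.symm)
  rw [appPushforward_res, appPushforward_res, H, appPushforward_res]
  exact (res_res _ _ _ _).trans (res_res _ _ _ _).symm

end BaseChange

end AlgebraicGeometry.Scheme.Modules

/-! ### Infinitesimal neighbourhoods of the diagonal and Taylor morphisms. -/

namespace JetBundle

open Scheme.Modules Limits

variable {Z X S : Scheme.{u}} (a : Z ⟶ X) (π : X ⟶ S)

lemma p_diagonal_apply (x : X) : p π (pullback.diagonal π x) = x := by
  rw [← Scheme.Hom.comp_apply, pullback.diagonal_fst]
  rfl

/-- The morphism `Z ×_S Z ⟶ X ×_S X` induced by `Z ⟶ X`. -/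
noncomputable def prodMap : pullback (a ≫ π) (a ≫ π) ⟶ pullback π π :=
  pullback.map _ _ _ _ a a (𝟙 S) (by simp) (by simp)

lemma prodMap_p : prodMap a π ≫ p π = p (a ≫ π) ≫ a :=
  pullback.lift_fst _ _ _

lemma prodMap_q : prodMap a π ≫ q π = q (a ≫ π) ≫ a :=
  pullback.lift_snd _ _ _

lemma diagonal_prodMap :
    pullback.diagonal (a ≫ π) ≫ prodMap a π = a ≫ pullback.diagonal π := by
  apply pullback.hom_ext
  · rw [Category.assoc, Category.assoc, prodMap_p, pullback.diagonal_fst,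
      pullback.diagonal_fst_assoc, Category.comp_id]
  · rw [Category.assoc, Category.assoc, prodMap_q, pullback.diagonal_snd,
      pullback.diagonal_snd_assoc, Category.comp_id]

variable [IsSeparated π]

/-- A positive power of an ideal sheaf has the same support, and the diagonal is closed. -/
lemma range_infNhdι (l : ℕ) :
    Set.range (infNhdι π l) = Set.range (pullback.diagonal π) := by
  refine (Scheme.IdealSheafData.range_subschemeι _).trans ?_
  rw [Scheme.IdealSheafData.support_pow_succ, diagonalIdeal, Scheme.Hom.support_ker]
  exact (pullback.diagonal π).isClosedEmbedding.isClosed_range.closure_eq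

instance (l : ℕ) : IsClosedImmersion (infNhdι π l) :=
  inferInstanceAs (IsClosedImmersion (diagonalIdeal π ^ (l + 1)).subschemeι)

/-- The infinitesimal neighbourhoods of the diagonal have the same underlying space as `X`. -/
lemma isHomeomorph_infNhdι_p (l : ℕ) : IsHomeomorph (infNhdι π l ≫ p π) := by
  have hr (d : infNhd π l) : pullback.diagonal π ((infNhdι π l ≫ p π) d) = infNhdι π l d := by
    obtain ⟨x, hx⟩ : infNhdι π l d ∈ Set.range (pullback.diagonal π) :=
      range_infNhdι π l ▸ Set.mem_range_self d
    rw [Scheme.Hom.comp_apply, ← hx, p_diagonal_apply]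
  have hemb := (infNhdι π l).isClosedEmbedding
  refine isHomeomorph_iff_isEmbedding_surjective.mpr ⟨?_, fun x ↦ ?_⟩
  -- By `hr`, following this map by the diagonal gives back the embedding `infNhdι π l`.
  · refine .of_comp (infNhdι π l ≫ p π).continuous (pullback.diagonal π).continuous ?_
    convert hemb.isEmbedding using 1
    exact funext hr
  · obtain ⟨d, hd⟩ : pullback.diagonal π x ∈ Set.range (infNhdι π l) :=
      range_infNhdι π l ▸ Set.mem_range_self x
    exact ⟨d, by rw [Scheme.Hom.comp_apply, hd, p_diagonal_apply]⟩

variable [IsClosedImmersion a]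

instance : IsClosedImmersion (prodMap a π) :=
  have : MorphismProperty.IsStableUnderComposition @IsClosedImmersion.{u} :=
    ⟨fun _ _ _ _ ↦ inferInstance⟩
  MorphismProperty.pullbackMap (P := @IsClosedImmersion) ‹_› ‹_› rfl rfl

/-- Both sides are kernels: of the diagonal of `X`, and of that diagonal precomposed with `a`. -/
lemma diagonalIdeal_le_map :
    diagonalIdeal π ≤ (diagonalIdeal (a ≫ π)).map (prodMap a π) := by
  rw [diagonalIdeal, diagonalIdeal, Scheme.IdealSheafData.map_ker, diagonal_prodMap,
    ← Scheme.IdealSheafData.map_ker, ← Scheme.IdealSheafData.map_bot]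
  exact Scheme.IdealSheafData.map_mono _ bot_le

lemma diagonalIdeal_pow_le_map (n : ℕ) :
    diagonalIdeal π ^ n ≤ (diagonalIdeal (a ≫ π) ^ n).map (prodMap a π) := by
  intro U
  have h := diagonalIdeal_le_map a π U
  -- On affine opens `map` is a preimage of ideals, and a power of a preimage lies in the preimage
  -- of the power.
  rw [Scheme.IdealSheafData.ideal_map_of_isAffineHom] at h ⊢
  exact (Ideal.pow_right_mono h n).trans (Ideal.le_comap_pow _ n)

/-- The morphism between infinitesimal neighbourhoods of the diagonals induced by `Z ⟶ X`. -/
noncomputable def infNhdMap (l : ℕ) : infNhd (a ≫ π) l ⟶ infNhd π l :=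
  Scheme.IdealSheafData.subschemeMap _ _ (prodMap a π) (diagonalIdeal_pow_le_map a π (l + 1))

lemma infNhdMap_infNhdι (l : ℕ) :
    infNhdMap a π l ≫ infNhdι π l = infNhdι (a ≫ π) l ≫ prodMap a π :=
  Scheme.IdealSheafData.subschemeMap_subschemeι _ _ _ _

instance (l : ℕ) : IsClosedImmersion (infNhdMap a π l) :=
  have : IsClosedImmersion (infNhdMap a π l ≫ infNhdι π l) := by
    rw [infNhdMap_infNhdι]; infer_instance
  .of_comp_isClosedImmersion _ (infNhdι π l)

lemma infNhdMap_p (l : ℕ) :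
    infNhdι (a ≫ π) l ≫ p (a ≫ π) ≫ a = infNhdMap a π l ≫ infNhdι π l ≫ p π := by
  rw [← Category.assoc (infNhdMap a π l), infNhdMap_infNhdι, Category.assoc, prodMap_p]

lemma infNhdMap_q (l : ℕ) :
    infNhdι (a ≫ π) l ≫ q (a ≫ π) ≫ a = infNhdMap a π l ≫ infNhdι π l ≫ q π := by
  rw [← Category.assoc (infNhdMap a π l), infNhdMap_infNhdι, Category.assoc, prodMap_q]


variable (l : ℕ) (F : X.Modules)

/-- The pullback `j^* q^* F` of `F` to the infinitesimal neighbourhood of the diagonal. -/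
noncomputable abbrev infNhdPullback : (infNhd π l).Modules :=
  (Scheme.Modules.pullback (infNhdι π l)).obj ((Scheme.Modules.pullback (q π)).obj F)

/-- Puts the Taylor morphisms of `X` and `Z` in the common form to which `baseChangeLift_comp`
applies. -/
lemma taylorMap_eq_baseChangeLift :
    taylorMap π l F = baseChangeLift pullback.condition.symm (pullbackUnit (q π) F)
      (pullbackUnit (infNhdι π l) ((Scheme.Modules.pullback (q π)).obj F)) := rfl

/-- The comparison morphism `j^* q^* F ⟶ f_* j^* q^* a^* F`, where `f` is the morphism between
infinitesimal neighbourhoods induced by `a`. -/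
noncomputable def infNhdPullbackMap : infNhdPullback π l F ⟶
    (Scheme.Modules.pushforward (infNhdMap a π l)).obj
      (infNhdPullback (a ≫ π) l ((Scheme.Modules.pullback a).obj F)) :=
  squareMap (infNhdMap_q a π l) (pullbackUnit a F) (pullbackUnit _ _) (pullbackUnit _ _)

lemma isLocallySurjective_infNhdPullbackMap :
    Scheme.Modules.IsLocallySurjective (infNhdPullbackMap a π l F) :=
  isLocallySurjective_of_generates _ _ fun _ u v h ↦
    squareMap_pullbackUnit_generates (infNhdMap_q a π l) u v h

/-- Taylor morphisms are compatible with pullback along a closed immersion. -/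
lemma taylorMap_comp_infNhdPullbackMap :
    taylorMap π l F ≫ (Scheme.Modules.pushforward (p π)).map
        ((Scheme.Modules.pushforward (infNhdι π l)).map (infNhdPullbackMap a π l F)) =
      globalSectionsMap π (pullbackUnit a F) ≫ (Scheme.Modules.pushforward a).map
        (taylorMap (a ≫ π) l ((Scheme.Modules.pullback a).obj F)) ≫
        (pushforwardTriple (infNhdMap_p a π l)
          (infNhdPullback (a ≫ π) l ((Scheme.Modules.pullback a).obj F))).hom := by
  rw [taylorMap_eq_baseChangeLift, taylorMap_eq_baseChangeLift]
  exact baseChangeLift_comp _ _ (infNhdMap_p a π l) (infNhdMap_q a π l) _ _ _ _ _ _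
    (squareMap_app (infNhdMap_q a π l) _ _ _)

/-- If the Taylor morphism of `F` is surjective, so is that of the pullback of `F` to a closed
subscheme. -/
theorem epi_taylorMap_pullback [Epi (taylorMap π l F)] :
    Epi (taylorMap (a ≫ π) l ((Scheme.Modules.pullback a).obj F)) := by
  have := faithful_pushforward a a.isClosedEmbedding.isInducing
  refine (Scheme.Modules.pushforward a).epi_of_epi_map ?_
  have h₁ : Epi ((Scheme.Modules.pushforward (infNhdι π l ≫ p π)).map
      (infNhdPullbackMap a π l F)) :=
    ((isLocallySurjective_infNhdPullbackMap a π l F).pushforward _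
      (isHomeomorph_infNhdι_p π l).isClosedEmbedding).epi
  have h₂ := epi_pushforward_map_map (infNhdι π l) (p π) (infNhdPullbackMap a π l F) h₁
  exact epi_middle (taylorMap_comp_infNhdPullbackMap a π l F) ‹_› h₂

end JetBundle

theorem theorem3p4 {K : Type u} [Field K] (N l : ℕ) {Z : Scheme.{u}}
    (i : Z ⟶ JetBundle.projectiveSpace N K) [IsClosedImmersion i]
    (hZ : JetBundle.IsProjectivelyNormal i)
    (F : (JetBundle.projectiveSpace N K).Modules) (hF : JetBundle.IsCoherent F)
    (hT : Epi (JetBundle.taylorMap (JetBundle.projectiveSpaceStr N K) l F)) :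
    Epi (JetBundle.taylorMap (i ≫ JetBundle.projectiveSpaceStr N K) l
      ((Scheme.Modules.pullback i).obj F)) :=
  JetBundle.epi_taylorMap_pullback i (JetBundle.projectiveSpaceStr N K) l F
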